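/- Conventions. A (finite) partial Boolean algebra (PBA) is a finite set \(X\) with a non-empty family \(\mathcal F\) of Boolean algebras whose carriers are subsets of \(X\) with union \(X\), such that: the intersection of two members of \(\mathcal F\) is a member of \(\mathcal F\), the Boolean operations of any two members coincide on their intersection, and every Boolean subalgebra of a member is a member. All members share the zero \(\emptyset\) and the unit \(\mathbf 1\). A context is a maximal member of \(\mathcal F\); a subset of \(X\) is compatible if it is contained in a context. A state is a map \(f:X\to[0,1]\) whose restriction to each member of \(\mathcal F\) is a normalized finitely additive measure; a PBA with a state is a partial probability theory (PPT). A family of states \((f_k)_k\) is complete if for every \(A\in X\), \(A\ne\emptyset\), some \(f_k(A)\neq 0\); it is separating if moreover for all \(A\neq B\) in \(X\) some \(f_k(A)\ne f_k(B)\). A classical representation of a PPT \((X,\mathcal F;f)\) is a Boolean algebra \(\mathfrak B\) with a normalized measure \(\mu\) such that, up to isomorphism, \(X\subset\mathfrak B\), the members of \(\mathcal F\) are Boolean subalgebras of \(\mathfrak B\), \(X\) generates \(\mathfrak B\), and \(\mu|_X=f\). Let \(\{\widetilde{\mathcal C}_k\}_{k\in K}=\{(\widetilde X,\{\widetilde{\mathfrak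 B}_j\}_{j\in J};\tilde f_k)\}_{k\in K}\) be a collection of PPTs on one PBA, with \(\{\tilde f_k\}_{k\in K}\) complete. Let \(\widetilde{\mathcal G}=\{\widetilde A_1,\dots,\widetilde A_n\}\subset\widetilde X\) be a set of generators (each context is generated by a subset of \(\widetilde{\mathcal G}\)) with the property (G) for all \(m\ge 1\) and all contexts \(\widetilde{\mathfrak B}_{i_1},\dots,\widetilde{\mathfrak B}_{i_m}\), generated respectively by maximal compatible subsets \(\widetilde{\mathcal G}_{i_1},\dots,\widetilde{\mathcal G}_{i_m}\) of \(\widetilde{\mathcal G}\), if \(\widetilde{\mathfrak B}_{i_1}\cap\dots\cap\widetilde{\mathfrak B}_{i_m}\ne\{\emptyset,\mathbf 1\}\), then \(\widetilde{\mathcal G}_{i_1}\cap\dots\cap\widetilde{\mathcal G}_{i_m}\) is non-empty and generates \(\widetilde{\mathfrak B}_{i_1}\cap\dots\cap\widetilde{\mathfrak B}_{i_m}\). The associated free Horn–Tarski PPTs \(\mathcal C_k=(X,\{\mathfrak B_i\}_{i\in I};f_k)\), \(k\in K\), are defined as follows. In the Boolean algebra freely generated by symbols \(A_1,\dots,A_n\),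 let \(\mathfrak B(S)\) be the subalgebra generated by \(\{A_s: s\in S\}\). The PBA \(\{\mathfrak B_i\}_{i\in I}\) consists of the algebras \(\mathfrak B(S)\), for all \(S\subset\{1,\dots,n\}\) such that \(\{\widetilde A_s: s\in S\}\) is compatible, and of all their subalgebras, and \(X\) is their union. The state \(f_k\) is the one whose restriction to each such \(\mathfrak B(S)\) is the measure with \[f_k\Big(\bigcap_{s\in E}A_s\cap\bigcap_{s\in S\setminus E}A_s^c\Big)=\tilde f_k\Big(\bigcap_{s\in E}\widetilde A_s\cap\bigcap_{s\in S\setminus E}\widetilde A_s^c\Big)\qquad(E\subset S);\] these measures coincide on intersections. Theorem. (a) If, for a given \(k\in K\), \(\widetilde{\mathcal C}_k\) admits a classical representation, then so does \(\mathcal C_k\). (b) If \(K'\subset K\) is such that \(\{\tilde f_k\}_{k\in K'}\) is separating for \(\{\widetilde{\mathfrak B}_j\}_{j\in J}\) and \(\mathcal C_k\) admits a classical representation for all \(k\in K'\), then \(\widetilde{\mathcal C}_k\) admits a classical representation for all \(k\in K'\). -/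

import Mathlib

universe u v

/-- A normalized (finitely additive) measure on a Boolean algebra. -/
structure IsNormalizedMeasure {𝔅 : Type u} [BooleanAlgebra 𝔅] (m : 𝔅 → ℝ) : Prop where
  nonneg : ∀ a, 0 ≤ m a
  additive : ∀ a b, Disjoint a b → m (a ⊔ b) = m a + m b
  top : m ⊤ = 1

/-- A partial Boolean algebra with underlying set `X`: a non-empty family of Boolean algebras
covering `X`, each carried by a subset of `X`, closed under intersections, with operations which
coincide on intersections, and containing all Boolean subalgebras of its members. The family is
given as the set of the carriers together with a Boolean algebra structure on each of them (by
`inf_eq`, `sup_eq` and `compl_eq` a carrier determines its structure). -/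
structure PartialBooleanAlgebra (X : Type u) where
  /-- the carriers of the Boolean algebras of the family -/
  algebras : Set (Set X)
  /-- the Boolean algebra structure on each carrier -/
  [boolAlg : ∀ B : algebras, BooleanAlgebra (B : Set X)]
  nonempty : algebras.Nonempty
  cover : ⋃₀ algebras = Set.univ
  inter_mem : ∀ B ∈ algebras, ∀ C ∈ algebras, B ∩ C ∈ algebras
  inf_eq : ∀ (B C : algebras) (x y : X) (hxB : x ∈ (B : Set X)) (hyB : y ∈ (B : Set X))
    (hxC : x ∈ (C : Set X)) (hyC : y ∈ (C : Set X)),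
    (((⟨x, hxB⟩ : (B : Set X)) ⊓ ⟨y, hyB⟩ : (B : Set X)) : X) =
      ((⟨x, hxC⟩ : (C : Set X)) ⊓ ⟨y, hyC⟩ : (C : Set X))
  sup_eq : ∀ (B C : algebras) (x y : X) (hxB : x ∈ (B : Set X)) (hyB : y ∈ (B : Set X))
    (hxC : x ∈ (C : Set X)) (hyC : y ∈ (C : Set X)),
    (((⟨x, hxB⟩ : (B : Set X)) ⊔ ⟨y, hyB⟩ : (B : Set X)) : X) =
      ((⟨x, hxC⟩ : (C : Set X)) ⊔ ⟨y, hyC⟩ : (C : Set X))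
  compl_eq : ∀ (B C : algebras) (x : X) (hxB : x ∈ (B : Set X)) (hxC : x ∈ (C : Set X)),
    (((⟨x, hxB⟩ : (B : Set X))ᶜ : (B : Set X)) : X) = ((⟨x, hxC⟩ : (C : Set X))ᶜ : (C : Set X))
  subalgebra_mem : ∀ (B : algebras) (L : BooleanSubalgebra (B : Set X)),
    Subtype.val '' (L : Set (B : Set X)) ∈ algebras

attribute [instance] PartialBooleanAlgebra.boolAlg

namespace PartialBooleanAlgebra

variable {X : Type u} (P : PartialBooleanAlgebra X)

/-! ### Zero and unit -/

/-- Some Boolean algebra of the family. -/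
noncomputable def someAlgebra : P.algebras := ⟨P.nonempty.some, P.nonempty.some_mem⟩

/-- The common zero element of all the Boolean algebras of the family. -/
noncomputable def zero : X :=
  ((⊥ : (P.someAlgebra : Set X)) : X)

/-- The common unit of all the Boolean algebras of the family. -/
noncomputable def one : X :=
  ((⊤ : (P.someAlgebra : Set X)) : X)

theorem coe_bot_eq (B C : P.algebras) : ((⊥ : (B : Set X)) : X) = ((⊥ : (C : Set X)) : X) := by
  obtain ⟨D, hD⟩ : ∃ D : P.algebras, (D : Set X) = (B : Set X) ∩ C :=
    ⟨⟨_, P.inter_mem _ B.2 _ C.2⟩, rfl⟩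
  obtain ⟨x, hx⟩ : ∃ x : X, x ∈ (D : Set X) := ⟨_, (⊥ : (D : Set X)).2⟩
  have key : ∀ E : P.algebras, ∀ h : x ∈ (E : Set X), (D : Set X) ⊆ E →
      ((⊥ : (E : Set X)) : X) = ((⊥ : (D : Set X)) : X) := by
    intro E h hDE
    have h1 := P.compl_eq D E x hx h
    have h2 := P.inf_eq D E x _ hx ((⟨x, hx⟩ : (D : Set X))ᶜ).2 h (hDE ((⟨x, hx⟩ : (D : Set X))ᶜ).2)
    have h3 : (⟨_, hDE ((⟨x, hx⟩ : (D : Set X))ᶜ).2⟩ : (E : Set X)) = (⟨x, h⟩ : (E : Set X))ᶜ :=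
      Subtype.ext h1
    rw [h3] at h2
    simpa using h2.symm
  have hx2 : x ∈ (B : Set X) ∩ C := hD ▸ hx
  rw [key B hx2.1 (hD ▸ Set.inter_subset_left), key C hx2.2 (hD ▸ Set.inter_subset_right)]

theorem coe_bot (B : P.algebras) : ((⊥ : (B : Set X)) : X) = P.zero := P.coe_bot_eq _ _

theorem coe_top (B : P.algebras) : ((⊤ : (B : Set X)) : X) = P.one := by
  have h : ∀ C : P.algebras, ∃ hz : P.zero ∈ (C : Set X),
      ((⊤ : (C : Set X)) : X) = ((⟨P.zero, hz⟩ : (C : Set X))ᶜ : (C : Set X)) := by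
    intro C
    refine ⟨P.coe_bot C ▸ (⊥ : (C : Set X)).2, ?_⟩
    have : (⟨P.zero, P.coe_bot C ▸ (⊥ : (C : Set X)).2⟩ : (C : Set X)) = ⊥ :=
      Subtype.ext (P.coe_bot C).symm
    rw [this, compl_bot]
  obtain ⟨h1, e1⟩ := h B
  obtain ⟨h2, e2⟩ := h P.someAlgebra
  rw [e1, P.compl_eq B _ _ h1 h2, ← e2]
  rfl

/-! ### States -/

/-- A state on a partial Boolean algebra; the pair consisting of a partial Boolean algebra and a
state on it is a partial probability theory. -/
structure State where
  toFun : X → ℝ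
  mem_Icc : ∀ x, toFun x ∈ Set.Icc (0 : ℝ) 1
  isMeasure : ∀ B : P.algebras, IsNormalizedMeasure (fun x : (B : Set X) => toFun x)

instance : CoeFun P.State (fun _ => X → ℝ) := ⟨State.toFun⟩

variable {P} in
/-- Completeness of a family of states. -/
def Complete {K : Type v} (f : K → P.State) : Prop :=
  ∀ A : X, A ≠ P.zero → ∃ k, f k A ≠ 0

variable {P} in
/-- A separating family of states. -/
def Separating {K : Type v} (f : K → P.State) : Prop :=
  Complete f ∧ ∀ A B : X, A ≠ B → ∃ k, f k A ≠ f k B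

/-- `(𝔅, μ)`, together with the embedding `ι` of `X` in `𝔅`, is a classical representation of the
partial probability theory `(P, f)`: up to the identification of `X` with its image, the members of
the family are subalgebras of `𝔅`, `X` generates `𝔅`, and `μ` is a normalized measure on `𝔅` which
extends `f`. -/
structure IsClassicalRepresentation (f : P.State) {𝔅 : Type u} [BooleanAlgebra 𝔅]
    (ι : X → 𝔅) (μ : 𝔅 → ℝ) : Prop where
  injective : Function.Injective ι
  map_inf : ∀ (B : P.algebras) (x y : (B : Set X)), ι ↑(x ⊓ y) = ι x ⊓ ι y
  map_sup : ∀ (B : P.algebras) (x y : (B : Set X)), ι ↑(x ⊔ y) = ι x ⊔ ι y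
  map_compl : ∀ (B : P.algebras) (x : (B : Set X)), ι ↑(xᶜ) = (ι x)ᶜ
  generates : BooleanSubalgebra.closure (Set.range ι) = ⊤
  isMeasure : IsNormalizedMeasure μ
  extends_state : ∀ x, μ (ι x) = f x

/-- The partial probability theory `(P, f)` admits a classical representation. -/
def HasClassicalRepresentation (f : P.State) : Prop :=
  ∃ (𝔅 : Type u) (_ : BooleanAlgebra 𝔅) (ι : X → 𝔅) (μ : 𝔅 → ℝ),
    P.IsClassicalRepresentation f ι μ

/-! ### Contexts, compatibility, generators -/

/-- A context is a maximal Boolean algebra of the family. -/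
def IsContext (B : Set X) : Prop := Maximal (fun B => B ∈ P.algebras) B

/-- The elements of `S` are (jointly) compatible: they belong to a common context. -/
def Compatible (S : Set X) : Prop := ∃ B, P.IsContext B ∧ S ⊆ B

/-- `B` is a Boolean algebra of the family and it is generated by its subset `S`. -/
def GeneratesAlgebra (S B : Set X) : Prop :=
  ∃ C : P.algebras, (C : Set X) = B ∧ S ⊆ B ∧
    BooleanSubalgebra.closure {x : (C : Set X) | (x : X) ∈ S} = ⊤

/-- `G` is a set of generators: each context is generated by a subset of `G`. -/
def IsGenerating (G : Set X) : Prop :=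
  ∀ B, P.IsContext B → ∃ S ⊆ G, P.GeneratesAlgebra S B

/-- `S` is a maximal subset of compatible elements of `G`. -/
def IsMaximalCompatible (G S : Set X) : Prop :=
  Maximal (fun S => S ⊆ G ∧ P.Compatible S) S

/-- Property (G). -/
def PropertyG (G : Set X) : Prop :=
  ∀ (n : ℕ), 1 ≤ n → ∀ (B S : Fin n → Set X),
    (∀ i, P.IsContext (B i)) →
    (∀ i, P.IsMaximalCompatible G (S i) ∧ P.GeneratesAlgebra (S i) (B i)) →
    (⋂ i, B i) ≠ {P.zero, P.one} →
    (⋂ i, S i).Nonempty ∧ P.GeneratesAlgebra (⋂ i, S i) (⋂ i, B i)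

theorem exists_context [Finite X] : ∃ B, P.IsContext B := by
  obtain ⟨B, hB⟩ := P.nonempty
  obtain ⟨C, -, hC⟩ := (Set.toFinite P.algebras).exists_le_maximal hB
  exact ⟨C, hC⟩

end PartialBooleanAlgebra

/-! ### Partial Boolean algebras of subalgebras of a Boolean algebra -/

section OfSubalgebras

variable {𝔄 : Type u} [BooleanAlgebra 𝔄]

/-- The union of a family of subalgebras of a Boolean algebra. -/
def UnionOfSubalgebras (𝓛 : Set (BooleanSubalgebra 𝔄)) : Type u := {a : 𝔄 // ∃ L ∈ 𝓛, a ∈ L}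

/-- The elements of the union that lie in `L`. -/
def UnionOfSubalgebras.part (𝓛 : Set (BooleanSubalgebra 𝔄)) (L : BooleanSubalgebra 𝔄) :
    Set (UnionOfSubalgebras 𝓛) := {x | x.1 ∈ L}

/-- The Boolean algebra structure, inherited from `𝔄`, on a subset of the union of `𝓛` which is (the
carrier of) a member of `𝓛`. -/
noncomputable abbrev UnionOfSubalgebras.booleanAlgebra (𝓛 : Set (BooleanSubalgebra 𝔄))
    (B : Set (UnionOfSubalgebras 𝓛)) (hB : ∃ L ∈ 𝓛, B = UnionOfSubalgebras.part 𝓛 L) :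
    BooleanAlgebra B :=
  have mem : ∀ a : 𝔄, a ∈ hB.choose → ∃ L ∈ 𝓛, a ∈ L :=
    fun _ ha => ⟨_, hB.choose_spec.1, ha⟩
  have inn : ∀ x : B, x.1.1 ∈ hB.choose := fun x => by
    have h : x.1 ∈ UnionOfSubalgebras.part 𝓛 hB.choose := hB.choose_spec.2 ▸ x.2
    exact h
  have back : ∀ (a : 𝔄) (ha : a ∈ hB.choose), (⟨a, mem a ha⟩ : UnionOfSubalgebras 𝓛) ∈ B :=
    fun a ha => by
      have h : (⟨a, mem a ha⟩ : UnionOfSubalgebras 𝓛) ∈ UnionOfSubalgebras.part 𝓛 hB.choose := ha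
      exact hB.choose_spec.2 ▸ h
  letI mk : (a : 𝔄) → a ∈ hB.choose → B := fun a ha => ⟨⟨a, mem a ha⟩, back a ha⟩
  letI : Max B := ⟨fun x y => mk (x.1.1 ⊔ y.1.1) (BooleanSubalgebra.sup_mem (inn x) (inn y))⟩
  letI : Min B := ⟨fun x y => mk (x.1.1 ⊓ y.1.1) (BooleanSubalgebra.inf_mem (inn x) (inn y))⟩
  letI : LE B := ⟨fun x y => x.1.1 ≤ y.1.1⟩
  letI : LT B := ⟨fun x y => x.1.1 < y.1.1⟩
  letI : Top B := ⟨mk ⊤ BooleanSubalgebra.top_mem⟩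
  letI : Bot B := ⟨mk ⊥ BooleanSubalgebra.bot_mem⟩
  letI : Compl B := ⟨fun x => mk (x.1.1)ᶜ (BooleanSubalgebra.compl_mem (inn x))⟩
  letI : SDiff B := ⟨fun x y => mk (x.1.1 \ y.1.1) (BooleanSubalgebra.sdiff_mem (inn x) (inn y))⟩
  letI : HImp B := ⟨fun x y => mk (x.1.1 ⇨ y.1.1) (BooleanSubalgebra.himp_mem (inn x) (inn y))⟩
  Function.Injective.booleanAlgebra (fun x : B => x.1.1)
    (fun _ _ h => Subtype.ext (Subtype.ext h)) Iff.rfl Iff.rfl (fun _ _ => rfl) (fun _ _ => rfl)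
    rfl rfl (fun _ => rfl) (fun _ _ => rfl) (fun _ _ => rfl)

/-- The partial Boolean algebra whose Boolean algebras are the members of a non-empty family `𝓛` of
subalgebras of `𝔄`, where `𝓛` contains all subalgebras of its members. -/
noncomputable def PartialBooleanAlgebra.ofSubalgebras (𝓛 : Set (BooleanSubalgebra 𝔄))
    (hne : 𝓛.Nonempty) (hlow : IsLowerSet 𝓛) :
    PartialBooleanAlgebra (UnionOfSubalgebras 𝓛) where
  algebras := {B | ∃ L ∈ 𝓛, B = UnionOfSubalgebras.part 𝓛 L}
  boolAlg B := UnionOfSubalgebras.booleanAlgebra 𝓛 B.1 B.2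
  nonempty := hne.elim fun L hL => ⟨_, L, hL, rfl⟩
  cover := by
    refine Set.eq_univ_of_forall fun x => ?_
    obtain ⟨L, hL, hx⟩ := x.2
    exact ⟨_, ⟨L, hL, rfl⟩, hx⟩
  inter_mem := by
    rintro _ ⟨L, hL, rfl⟩ _ ⟨M, hM, rfl⟩
    exact ⟨L ⊓ M, hlow inf_le_left hL, rfl⟩
  inf_eq _ _ _ _ _ _ _ _ := rfl
  sup_eq _ _ _ _ _ _ _ _ := rfl
  compl_eq _ _ _ _ _ := rfl
  subalgebra_mem := by
    intro B M
    obtain ⟨L, hL, hBL⟩ := B.2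
    let : BooleanAlgebra (B : Set (UnionOfSubalgebras 𝓛)) :=
      UnionOfSubalgebras.booleanAlgebra 𝓛 B.1 B.2
    refine ⟨{ carrier := {a | ∃ x ∈ M, x.1.1 = a}
              supClosed' := ?_
              infClosed' := ?_
              compl_mem' := ?_
              bot_mem' := ⟨⊥, M.bot_mem', rfl⟩ }, hlow ?_ hL, ?_⟩
    · rintro _ ⟨x, hx, rfl⟩ _ ⟨y, hy, rfl⟩
      exact ⟨x ⊔ y, M.supClosed' hx hy, rfl⟩
    · rintro _ ⟨x, hx, rfl⟩ _ ⟨y, hy, rfl⟩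
      exact ⟨x ⊓ y, M.infClosed' hx hy, rfl⟩
    · rintro _ ⟨x, hx, rfl⟩
      exact ⟨xᶜ, M.compl_mem' hx, rfl⟩
    · rintro _ ⟨x, hx, rfl⟩
      have h : x.1 ∈ UnionOfSubalgebras.part 𝓛 L := hBL ▸ x.2
      exact h
    · ext x
      constructor
      · rintro ⟨y, hy, rfl⟩
        exact ⟨y, hy, rfl⟩
      · rintro ⟨y, hy, hyx⟩
        exact ⟨y, hy, Subtype.ext hyx⟩

end OfSubalgebras

/-! ### The free Horn-Tarski partial probability theories -/

namespace PartialBooleanAlgebra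

open scoped Classical

variable {X : Type u}

/-- The Boolean algebra freely generated by the finite set `G`, realized as the algebra of all sets
of assignments of truth values to the elements of `G`. -/
abbrev FreeAlgebra (G : Finset X) : Type u := Set (G → Bool)

/-- The free generator corresponding to `g`. -/
def freeGen (G : Finset X) (g : G) : FreeAlgebra G := {η | η g = true}

/-- The subalgebra (freely) generated by the free generators which correspond to elements of `S`. -/
def freeSub (G S : Finset X) : BooleanSubalgebra (FreeAlgebra G) :=
  BooleanSubalgebra.closure {A | ∃ g : G, (g : X) ∈ S ∧ A = freeGen G g}

variable (P : PartialBooleanAlgebra X)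

/-- The algebras freely generated by the subsets of compatible elements of `G`, together with all
their subalgebras. -/
def freeSubalgebras (G : Finset X) : Set (BooleanSubalgebra (FreeAlgebra G)) :=
  {L | ∃ S : Finset X, S ⊆ G ∧ P.Compatible S ∧ L ≤ freeSub G S}

/-- The underlying set of the free partial Boolean algebra. -/
abbrev FreeObservable (G : Finset X) : Type u := UnionOfSubalgebras (P.freeSubalgebras G)

/-- The partial Boolean algebra of the Boolean algebras freely generated by the subsets of compatible
elements of `G`. -/
noncomputable def free [Finite X] (G : Finset X) : PartialBooleanAlgebra (P.FreeObservable G) :=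
  PartialBooleanAlgebra.ofSubalgebras (P.freeSubalgebras G)
    (P.exists_context.elim fun B hB =>
      ⟨freeSub G ∅, ∅, Finset.empty_subset _, ⟨B, hB, by simp⟩, le_rfl⟩)
    (fun _ _ hLM ⟨S, hS, hc, hL⟩ => ⟨S, hS, hc, hLM.trans hL⟩)

/-- An element of `X` as an element of the algebra `B`; only used for elements of `B`. -/
noncomputable def toAlgebra (B : P.algebras) (x : X) : (B : Set X) :=
  if h : x ∈ (B : Set X) then ⟨x, h⟩ else ⊥

/-- For `E ⊆ S ⊆ B`, the intersection, in the algebra `B`, of the elements of `E` and of the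
complements of the elements of `S \ E`. -/
noncomputable def minterm (B : P.algebras) (S E : Finset X) : (B : Set X) :=
  S.inf fun g => if g ∈ E then P.toAlgebra B g else (P.toAlgebra B g)ᶜ

/-- For `E ⊆ S ⊆ G`, the intersection, in the free algebra, of the generators corresponding to
elements of `E` and of the complements of those corresponding to elements of `S \ E`. These are the
atoms of the algebra freely generated by `S`. -/
def freeMinterm (G S E : Finset X) : FreeAlgebra G :=
  ⋂ g : {g : G // (g : X) ∈ S}, if (g : X) ∈ E then freeGen G g else (freeGen G g)ᶜ

/-- The measure on the algebra freely generated by `S`, where `S` is contained in the algebra `B`,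
whose value at each atom is the value of the state `f` at the corresponding element of `B`. -/
noncomputable def freeMeasure (G : Finset X) (f : P.State) (B : P.algebras) (S : Finset X)
    (A : FreeAlgebra G) : ℝ :=
  ∑ E ∈ S.powerset with freeMinterm G S E ⊆ A, f (P.minterm B S E)

variable {P}

theorem toAlgebra_coe {B : P.algebras} {x : X} (h : x ∈ (B : Set X)) :
    P.toAlgebra B x = ⟨x, h⟩ := by
  simp [toAlgebra, h]

theorem minterm_indep (B C : P.algebras) (S E : Finset X) (hB : (S : Set X) ⊆ B)
    (hC : (S : Set X) ⊆ C) : (P.minterm B S E : X) = P.minterm C S E := by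
  induction S using Finset.induction_on with
  | empty => simp only [minterm, Finset.inf_empty, coe_top]
  | insert a S ha ih =>
    simp only [Finset.coe_insert, Set.insert_subset_iff] at hB hC
    have ih := ih hB.2 hC.2
    simp only [minterm, Finset.inf_insert] at ih ⊢
    set x := S.inf fun g => if g ∈ E then P.toAlgebra B g else (P.toAlgebra B g)ᶜ
    set y := S.inf fun g => if g ∈ E then P.toAlgebra C g else (P.toAlgebra C g)ᶜ
    have h : ((if a ∈ E then P.toAlgebra B a else (P.toAlgebra B a)ᶜ : (B : Set X)) : X) =
        (if a ∈ E then P.toAlgebra C a else (P.toAlgebra C a)ᶜ : (C : Set X)) := by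
      rw [toAlgebra_coe hB.1, toAlgebra_coe hC.1]
      split_ifs
      · rfl
      · exact P.compl_eq B C a hB.1 hC.1
    generalize (if a ∈ E then P.toAlgebra B a else (P.toAlgebra B a)ᶜ : (B : Set X)) = z at h ⊢
    generalize (if a ∈ E then P.toAlgebra C a else (P.toAlgebra C a)ᶜ : (C : Set X)) = w at h ⊢
    obtain ⟨x, hx⟩ := x
    obtain ⟨y, hy⟩ := y
    obtain ⟨z, hz⟩ := z
    obtain ⟨w, hw⟩ := w
    simp only at ih h
    subst ih h
    exact P.inf_eq B C _ _ _ _ _ _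

/-- `A` only depends on the truth values of the elements of `S`. -/
def DependsOnly (G S : Finset X) (A : FreeAlgebra G) : Prop :=
  ∀ η θ : G → Bool, (∀ g : G, (g : X) ∈ S → η g = θ g) → (η ∈ A ↔ θ ∈ A)

theorem dependsOnly_of_mem {G S : Finset X} {A : FreeAlgebra G} (hA : A ∈ freeSub G S) :
    DependsOnly G S A := by
  unfold freeSub at hA
  induction hA using BooleanSubalgebra.closure_bot_sup_induction with
  | mem x hx =>
    obtain ⟨g, hg, rfl⟩ := hx
    intro η θ h
    simp [freeGen, h g hg]
  | bot => intro η θ _; rfl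
  | sup x hx y hy ihx ihy =>
    intro η θ h
    exact or_congr (ihx η θ h) (ihy η θ h)
  | compl x hx ih =>
    intro η θ h
    exact not_congr (ih η θ h)

theorem DependsOnly.mono {G S T : Finset X} {A : FreeAlgebra G} (h : DependsOnly G S A)
    (hST : S ⊆ T) : DependsOnly G T A :=
  fun η θ hηθ => h η θ fun g hg => hηθ g (hST hg)

theorem DependsOnly.inter {G S T : Finset X} {A : FreeAlgebra G} (hS : DependsOnly G S A)
    (hT : DependsOnly G T A) : DependsOnly G (S ∩ T) A := by
  intro η θ h
  rw [hS η (fun g => if (g : X) ∈ S then η g else θ g) fun g hg => by simp [hg]]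
  refine hT _ θ fun g hg => ?_
  by_cases hgS : (g : X) ∈ S
  · simpa [hgS] using h g (Finset.mem_inter.2 ⟨hgS, hg⟩)
  · simp [hgS]

theorem mem_freeMinterm {G S E : Finset X} {η : G → Bool} :
    η ∈ freeMinterm G S E ↔ ∀ g : G, (g : X) ∈ S → (η g = true ↔ (g : X) ∈ E) := by
  simp only [freeMinterm, Set.mem_iInter, Subtype.forall]
  refine forall_congr' fun g => forall_congr' fun hg => forall_congr' fun hgS => ?_
  split_ifs with h <;> simp [freeGen, h]

theorem freeMinterm_subset_iff {G S E : Finset X} {A : FreeAlgebra G} (hA : DependsOnly G S A) :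
    freeMinterm G S E ⊆ A ↔ (fun g : G => decide ((g : X) ∈ E)) ∈ A := by
  constructor
  · intro h
    exact h (mem_freeMinterm.2 fun g _ => by simp)
  · intro h η hη
    refine (hA η _ fun g hg => ?_).2 h
    rw [Bool.eq_iff_iff, mem_freeMinterm.1 hη g hg]
    simp

theorem freeMeasure_eq_sum {G S : Finset X} {f : P.State} {B : P.algebras} {A : FreeAlgebra G}
    (hA : DependsOnly G S A) : P.freeMeasure G f B S A =
      ∑ E ∈ S.powerset, if (fun g : G => decide ((g : X) ∈ E)) ∈ A then
        f (P.minterm B S E) else 0 := by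
  rw [freeMeasure, Finset.sum_filter]
  exact Finset.sum_congr rfl fun E _ => by simp only [freeMinterm_subset_iff hA]

theorem minterm_insert (B : P.algebras) (S E : Finset X) (a : X) :
    P.minterm B (insert a S) E =
      (if a ∈ E then P.toAlgebra B a else (P.toAlgebra B a)ᶜ) ⊓ P.minterm B S E := by
  simp [minterm, Finset.inf_insert]

theorem minterm_congr (B : P.algebras) (S E F : Finset X) (h : ∀ g ∈ S, (g ∈ E ↔ g ∈ F)) :
    P.minterm B S E = P.minterm B S F :=
  Finset.inf_congr rfl fun g hg => by simp only [h g hg]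

theorem freeMeasure_insert {G S : Finset X} {f : P.State} {B : P.algebras} {A : FreeAlgebra G}
    (hA : DependsOnly G S A) {a : X} (ha : a ∉ S) :
    P.freeMeasure G f B (insert a S) A = P.freeMeasure G f B S A := by
  rw [freeMeasure_eq_sum hA, freeMeasure_eq_sum (hA.mono (Finset.subset_insert a S)),
    Finset.sum_powerset_insert ha, ← Finset.sum_add_distrib]
  refine Finset.sum_congr rfl fun E hE => ?_
  have haE : a ∉ E := fun h => ha (Finset.mem_powerset.1 hE h)
  have h1 : ((fun g : G => decide ((g : X) ∈ insert a E)) ∈ A) ↔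
      ((fun g : G => decide ((g : X) ∈ E)) ∈ A) := by
    refine hA _ _ fun g hg => ?_
    have : (g : X) ≠ a := fun h => ha (h ▸ hg)
    simp [this]
  have h2 : P.minterm B S (insert a E) = P.minterm B S E :=
    minterm_congr _ _ _ _ fun g hg => by
      have : g ≠ a := fun h => ha (h ▸ hg)
      simp [this]
  simp only [h1]
  split_ifs
  · rw [minterm_insert, minterm_insert, h2, if_neg haE, if_pos (Finset.mem_insert_self a E)]
    have h3 := (f.isMeasure B).additive ((P.toAlgebra B a)ᶜ ⊓ P.minterm B S E)
      (P.toAlgebra B a ⊓ P.minterm B S E)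
      (disjoint_compl_left.mono inf_le_left inf_le_left)
    rw [← h3, ← inf_sup_right, sup_comm, sup_compl_eq_top, top_inf_eq]
  · simp

theorem freeMeasure_mono {G S T : Finset X} {f : P.State} {B : P.algebras} {A : FreeAlgebra G}
    (hA : DependsOnly G S A) (hST : S ⊆ T) :
    P.freeMeasure G f B T A = P.freeMeasure G f B S A := by
  rw [← Finset.union_eq_right.2 hST]
  clear hST
  induction T using Finset.induction_on with
  | empty => simp
  | insert a T _ ih =>
    rw [Finset.union_insert]
    by_cases ha : a ∈ S ∪ T
    · rw [Finset.insert_eq_of_mem ha, ih]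
    · rw [freeMeasure_insert (hA.mono Finset.subset_union_left) ha, ih]

/-- The measures on the algebras freely generated by subsets of compatible elements coincide on
intersections. -/
theorem freeMeasure_indep {G S T : Finset X} {f : P.State} {B C : P.algebras} {A : FreeAlgebra G}
    (hS : A ∈ freeSub G S) (hT : A ∈ freeSub G T) (hB : (S : Set X) ⊆ B) (hC : (T : Set X) ⊆ C) :
    P.freeMeasure G f B S A = P.freeMeasure G f C T A := by
  have h := (dependsOnly_of_mem hS).inter (dependsOnly_of_mem hT)
  rw [freeMeasure_mono h Finset.inter_subset_left, freeMeasure_mono h Finset.inter_subset_right]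
  refine Finset.sum_congr rfl fun E _ => ?_
  rw [minterm_indep B C _ _ (fun x hx => hB (Finset.inter_subset_left hx))
    (fun x hx => hC (Finset.inter_subset_right hx))]

theorem freeMeasure_univ {G S : Finset X} {f : P.State} {B : P.algebras} :
    P.freeMeasure G f B S Set.univ = 1 := by
  rw [freeMeasure_mono (S := ∅) (fun _ _ _ => Iff.rfl) (Finset.empty_subset S)]
  simpa [freeMeasure, minterm, Finset.filter_singleton] using (f.isMeasure B).top

theorem freeMeasure_nonneg {G S : Finset X} {f : P.State} {B : P.algebras} {A : FreeAlgebra G} :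
    0 ≤ P.freeMeasure G f B S A :=
  Finset.sum_nonneg fun _ _ => (f.mem_Icc _).1

theorem freeMeasure_le_one {G S : Finset X} {f : P.State} {B : P.algebras} {A : FreeAlgebra G} :
    P.freeMeasure G f B S A ≤ 1 := by
  rw [← freeMeasure_univ (G := G) (S := S) (f := f) (B := B)]
  refine Finset.sum_le_sum_of_subset_of_nonneg ?_ fun _ _ _ => (f.mem_Icc _).1
  exact Finset.monotone_filter_right _ fun E _ _ => Set.subset_univ _

theorem freeMeasure_union {G S : Finset X} {f : P.State} {B : P.algebras} {A C : FreeAlgebra G}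
    (hA : A ∈ freeSub G S) (hC : C ∈ freeSub G S) (h : Disjoint A C) :
    P.freeMeasure G f B S (A ∪ C) = P.freeMeasure G f B S A + P.freeMeasure G f B S C := by
  have hU : A ∪ C ∈ freeSub G S := BooleanSubalgebra.sup_mem hA hC
  rw [freeMeasure_eq_sum (dependsOnly_of_mem hA), freeMeasure_eq_sum (dependsOnly_of_mem hC),
    freeMeasure_eq_sum (dependsOnly_of_mem hU), ← Finset.sum_add_distrib]
  refine Finset.sum_congr rfl fun E _ => ?_
  by_cases h1 : (fun g : G => decide ((g : X) ∈ E)) ∈ A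
  · have h2 : (fun g : G => decide ((g : X) ∈ E)) ∉ C := fun h2 => Set.disjoint_left.1 h h1 h2
    simp [h1, h2]
  · simp [h1]

theorem exists_freeSub_mem {G : Finset X} (A : P.FreeObservable G) :
    ∃ (S : Finset X) (B : P.algebras), S ⊆ G ∧ P.IsContext B ∧ (S : Set X) ⊆ B ∧
      A.1 ∈ freeSub G S := by
  obtain ⟨L, ⟨S, hS, ⟨B, hB, hSB⟩, hL⟩, hA⟩ := A.2
  exact ⟨S, ⟨B, hB.1⟩, hS, hB, hSB, hL hA⟩

/-- The value of the state induced by `f` at `A`; see `freeValue_eq` for the independence of the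
choices. -/
noncomputable def freeValue (G : Finset X) (f : P.State) (A : P.FreeObservable G) : ℝ :=
  P.freeMeasure G f (exists_freeSub_mem A).choose_spec.choose (exists_freeSub_mem A).choose A.1

theorem freeValue_eq {G S : Finset X} {f : P.State} {B : P.algebras} {A : P.FreeObservable G}
    (hSB : (S : Set X) ⊆ B) (hA : A.1 ∈ freeSub G S) :
    freeValue G f A = P.freeMeasure G f B S A.1 :=
  freeMeasure_indep (exists_freeSub_mem A).choose_spec.choose_spec.2.2.2 hA
    (exists_freeSub_mem A).choose_spec.choose_spec.2.2.1 hSB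

variable (P)

/-- The state on the free partial Boolean algebra which is induced by the state `f`. -/
noncomputable def freeState [Finite X] (G : Finset X) (f : P.State) : (P.free G).State where
  toFun := freeValue G f
  mem_Icc _ := ⟨freeMeasure_nonneg, freeMeasure_le_one⟩
  isMeasure := by
    intro C
    obtain ⟨L, ⟨S, hS, ⟨B, hB, hSB⟩, hL⟩, hCL⟩ := C.2
    have hval : ∀ x : (C : Set (P.FreeObservable G)), x.1.1 ∈ freeSub G S := fun x => by
      have hx : x.1 ∈ UnionOfSubalgebras.part (P.freeSubalgebras G) L := hCL ▸ x.2
      exact hL hx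
    have key : ∀ x : (C : Set (P.FreeObservable G)),
        freeValue G f x.1 = P.freeMeasure G f ⟨B, hB.1⟩ S x.1.1 :=
      fun x => freeValue_eq hSB (hval x)
    refine ⟨fun _ => freeMeasure_nonneg, fun x y hxy => ?_, ?_⟩
    · have hd : Disjoint x.1.1 y.1.1 := by
        rw [disjoint_iff]
        exact congrArg (fun z => z.1.1) (disjoint_iff.1 hxy)
      refine (key _).trans ?_
      simp only [key x, key y]
      exact freeMeasure_union (hval x) (hval y) hd
    · exact (key _).trans freeMeasure_univ

end PartialBooleanAlgebra

/-! The algebra freely generated by `G` consists of all sets of truth assignments `G → Bool`. Any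
choice of images for the generators in a Boolean algebra extends to a homomorphism (`freeLift`), and
on expressions in the generators of a context the free state is the given state composed with
evaluation in that context (`freeMeasure_eq_evalIn`).

For (a), extend the embedding of the generators to the free algebra and pull the representing
measure back. Within a context this extension is evaluation followed by the embedding
(`IsClassicalRepresentation.freeLift_eq`), so the pulled-back measure extends the free state.

For (b), the same pullback gives for each k a measure m on sets of assignments that induces f_k on
every context (`exists_inducesState`). The free algebra forgets the relations between generators. To
restore them, keep only the assignments falsifying every expression that evaluates to ⊥ in some
context; the discarded ones are m-null because f_k vanishes at ⊥. Send x to the set of remaining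
assignments that satisfy an expression for x. Within one context all expressions for x agree on
these assignments; property (G) gives an expression valid in two contexts at once
(`exists_evalIn_eq_of_mem_inter`), so the context does not matter either. The map `truthSet` so
obtained respects the operations of each member, and m takes the value f_k(x) on the image of x. As
the map does not depend on k, the separating family makes it injective, and it serves as the
embedding for every k in K'. -/

/-! ### Finitely additive measures -/

theorem IsNormalizedMeasure.comp {𝔅 ℭ : Type*} [BooleanAlgebra 𝔅] [BooleanAlgebra ℭ] {m : 𝔅 → ℝ}
    (hm : IsNormalizedMeasure m) (φ : BoundedLatticeHom ℭ 𝔅) :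
    IsNormalizedMeasure fun a => m (φ a) where
  nonneg a := hm.nonneg _
  additive a b h := by rw [map_sup, hm.additive _ _ (h.map φ)]
  top := by rw [map_top, hm.top]

namespace IsNormalizedMeasure

variable {𝔅 : Type*} [BooleanAlgebra 𝔅] {m : 𝔅 → ℝ}

theorem bot (hm : IsNormalizedMeasure m) : m ⊥ = 0 := by
  have h := hm.additive ⊥ ⊥ disjoint_bot_left
  rw [bot_sup_eq] at h
  linarith

theorem mono (hm : IsNormalizedMeasure m) {a b : 𝔅} (h : a ≤ b) : m a ≤ m b := by
  rw [← sup_sdiff_cancel_right h, hm.additive _ _ disjoint_sdiff_self_right]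
  linarith [hm.nonneg (b \ a)]

theorem finset_sup (hm : IsNormalizedMeasure m) {ι : Type*} (s : Finset ι) (a : ι → 𝔅)
    (h : (s : Set ι).PairwiseDisjoint a) : m (s.sup a) = ∑ i ∈ s, m (a i) := by
  classical
  induction s using Finset.induction_on with
  | empty => simp [hm.bot]
  | insert i s hi ih =>
    rw [Finset.sup_insert, Finset.sum_insert hi, hm.additive, ih]
    · exact h.subset (by simp)
    · rw [Finset.disjoint_sup_right]
      intro j hj
      exact h (by simp) (by simp [hj]) (fun e => hi (e ▸ hj))

theorem eq_zero_of_forall_singleton {Ω : Type*} [Finite Ω] {m : Set Ω → ℝ}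
    (hm : IsNormalizedMeasure m) {N : Set Ω} (h : ∀ η ∈ N, m {η} = 0) : m N = 0 := by
  induction N, N.toFinite using Set.Finite.induction_on with
  | empty => exact hm.bot
  | @insert a s ha _ ih =>
    have e : insert a s = ({a} ⊔ s : Set Ω) := rfl
    rw [e, hm.additive _ _ (by simpa using ha), h a (by simp),
      ih fun η hη => h η (Set.mem_insert_of_mem _ hη), add_zero]

/-- The restriction of a measure on the subsets of a finite set to a subset of full measure. -/
theorem restrict {Ω : Type*} {m : Set Ω → ℝ} (hm : IsNormalizedMeasure m)
    {S : Set Ω} (h : m Sᶜ = 0) : IsNormalizedMeasure fun A : Set S => m (Subtype.val '' A) where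
  nonneg _ := hm.nonneg _
  additive A B hAB := by
    rw [← hm.additive _ _ ((Set.disjoint_image_iff Subtype.val_injective).2 hAB)]
    exact congrArg m (Set.image_union ..)
  top := by
    have h1 := hm.additive S Sᶜ disjoint_compl_right
    rw [sup_compl_eq_top, hm.top, h] at h1
    simpa using h1.symm

theorem image_preimage {Ω : Type*} {m : Set Ω → ℝ} (hm : IsNormalizedMeasure m)
    {S : Set Ω} (h : m Sᶜ = 0) (A : Set Ω) : m (Subtype.val '' ((↑) ⁻¹' A : Set S)) = m A := by
  rw [Subtype.image_preimage_coe]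
  have h1 := hm.additive (S ∩ A) (A \ S) (Set.disjoint_left.2 fun x hx hy => hy.2 hx.1)
  have h2 : m (A \ S) ≤ m Sᶜ := hm.mono fun x hx => hx.2
  have h3 := hm.nonneg (A \ S)
  have h4 : S ∩ A ⊔ A \ S = A := by rw [Set.inter_comm]; exact Set.inter_union_sdiff A S
  rw [h4] at h1
  linarith

end IsNormalizedMeasure

/-- A family of subsets which separates the points of a finite set generates all subsets. -/
theorem BooleanSubalgebra.closure_eq_top_of_separates {Ω : Type*} [Finite Ω] (𝒜 : Set (Set Ω))
    (h : ∀ a b : Ω, a ≠ b → ∃ A ∈ 𝒜, ¬(a ∈ A ↔ b ∈ A)) : BooleanSubalgebra.closure 𝒜 = ⊤ := by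
  classical
  have := Fintype.ofFinite Ω
  -- The case a = b is included, with the trivial witness ⊤, so that the meet over all b below
  -- isolates a.
  have sep : ∀ a b : Ω, ∃ A ∈ BooleanSubalgebra.closure 𝒜, a ∈ A ∧ (a ≠ b → b ∉ A) := by
    intro a b
    by_cases hab : a = b
    · exact ⟨⊤, BooleanSubalgebra.top_mem, trivial, fun h => (h hab).elim⟩
    · obtain ⟨A, hA, hA'⟩ := h a b hab
      have hm := BooleanSubalgebra.subset_closure hA
      by_cases ha : a ∈ A
      · exact ⟨A, hm, ha, fun _ hb => hA' (iff_of_true ha hb)⟩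
      · exact ⟨Aᶜ, BooleanSubalgebra.compl_mem hm, ha, fun _ hb => hA' (iff_of_false ha hb)⟩
  choose A hA haA hbA using sep
  have single : ∀ a, {a} ∈ BooleanSubalgebra.closure 𝒜 := by
    intro a
    have : ({a} : Set Ω) = Finset.univ.inf (A a) := by
      ext x
      simp only [Set.mem_singleton_iff, Finset.inf_set_eq_iInter, Set.mem_iInter, Finset.mem_univ,
        true_implies]
      constructor
      · rintro rfl b
        exact haA x b
      · intro hx
        by_contra hne
        exact hbA a x (Ne.symm hne) (hx x)
    rw [this]
    exact Finset.inf_induction BooleanSubalgebra.top_mem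
      (fun _ h1 _ h2 => BooleanSubalgebra.inf_mem h1 h2) fun b _ => hA a b
  refine eq_top_iff.2 fun B _ => ?_
  have : B = (Finset.univ.filter (· ∈ B)).sup fun a => ({a} : Set Ω) := by
    ext x
    simp
  rw [this]
  exact Finset.sup_induction BooleanSubalgebra.bot_mem
      (fun _ h1 _ h2 => BooleanSubalgebra.sup_mem h1 h2) fun b _ => single b

/-! ### Evaluation of truth tables in a Boolean algebra -/

section TruthTable

variable {I 𝔅 : Type*} [BooleanAlgebra 𝔅]

/-- The intersection of the `a g` with `η g = true` and of the complements of the others. -/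
def assignmentMeet [Fintype I] (a : I → 𝔅) (η : I → Bool) : 𝔅 :=
  Finset.univ.inf fun g => if η g then a g else (a g)ᶜ

variable [Fintype I]

theorem assignmentMeet_disjoint (a : I → 𝔅) {η θ : I → Bool} (h : η ≠ θ) :
    Disjoint (assignmentMeet a η) (assignmentMeet a θ) := by
  obtain ⟨g, hg⟩ := Function.ne_iff.1 h
  have h1 : ∀ η, assignmentMeet a η ≤ if η g then a g else (a g)ᶜ :=
    fun η => Finset.inf_le (Finset.mem_univ g)
  refine Disjoint.mono (h1 η) (h1 θ) ?_
  cases hη : η g <;> cases hθ : θ g <;> simp_all [disjoint_compl_left, disjoint_compl_right]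

open scoped Classical in
theorem sup_assignmentMeet (a : I → 𝔅) : Finset.univ.sup (assignmentMeet a) = ⊤ := by
  -- The coordinates in s have been freed: joining the two values of one more coordinate removes its
  -- literal. Once s is everything, the meet is empty, that is ⊤.
  have key : ∀ (s : Finset I) (η : I → Bool),
      (sᶜ.inf fun g => if η g then a g else (a g)ᶜ) ≤ Finset.univ.sup (assignmentMeet a) := by
    intro s
    induction s using Finset.induction_on with
    | empty =>
      intro η
      rw [Finset.compl_empty]
      exact Finset.le_sup (f := assignmentMeet a) (Finset.mem_univ η)
    | insert i s hi ih =>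
      intro η
      have hs : sᶜ = insert i (insert i s)ᶜ := by
        ext x; by_cases hx : x = i <;> simp_all
      have hc : ∀ b : Bool, ((insert i s)ᶜ.inf fun g =>
          if Function.update η i b g then a g else (a g)ᶜ) =
          (insert i s)ᶜ.inf fun g => if η g then a g else (a g)ᶜ := by
        intro b
        refine Finset.inf_congr rfl fun g hg => ?_
        have : g ≠ i := by rintro rfl; simp at hg
        simp [this]
      have h1 := ih (Function.update η i true)
      have h2 := ih (Function.update η i false)
      rw [hs, Finset.inf_insert, hc] at h1 h2
      simp only [Function.update_self, if_true, Bool.false_eq_true, if_false] at h1 h2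
      have h3 := sup_le h1 h2
      rwa [← inf_sup_right, sup_compl_eq_top, top_inf_eq] at h3
  simpa using key Finset.univ (fun _ => true)

open scoped Classical in
/-- The homomorphism from the Boolean algebra freely generated by `I` that extends `a`. -/
noncomputable def freeLift (a : I → 𝔅) : BoundedLatticeHom (Set (I → Bool)) 𝔅 where
  toFun A := (Finset.univ.filter (· ∈ A)).sup (assignmentMeet a)
  map_sup' A B := by
    rw [← Finset.sup_union]
    congr 1
    ext; simp
  map_inf' A B := by
    rw [Finset.sup_inf_sup]
    refine le_antisymm (Finset.sup_le fun η hη => ?_) (Finset.sup_le fun p hp => ?_)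
    · have h : η ∈ A ∧ η ∈ B := by simpa using hη
      refine le_trans (le_of_eq (inf_idem _).symm)
        (Finset.le_sup (f := fun p : (I → Bool) × (I → Bool) =>
          assignmentMeet a p.1 ⊓ assignmentMeet a p.2) (b := (η, η)) ?_)
      simp [h]
    · have h : p.1 ∈ A ∧ p.2 ∈ B := by simpa using hp
      by_cases he : p.1 = p.2
      · rw [← he, inf_idem]
        exact Finset.le_sup (f := assignmentMeet a) (by simpa [h.1] using he ▸ h.2)
      · rw [(assignmentMeet_disjoint a he).eq_bot]
        exact bot_le
  map_top' := by simp [sup_assignmentMeet]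
  map_bot' := by simp

open scoped Classical in
theorem freeLift_apply (a : I → 𝔅) (A : Set (I → Bool)) :
    freeLift a A = (Finset.univ.filter (· ∈ A)).sup (assignmentMeet a) := rfl

/-- Each assignment meet lies below its own literal at g, which gives ≤. The same bound for the
value false, after complementation, gives ≥. -/
theorem freeLift_gen (a : I → 𝔅) (g : I) : freeLift a {η | η g = true} = a g := by
  have key : ∀ b : Bool, freeLift a {η | η g = b} ≤ if b then a g else (a g)ᶜ := by
    intro b
    rw [freeLift_apply]
    refine Finset.sup_le fun η hη => ?_
    have h : η g = b := by simpa using hη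
    rw [← h]
    exact Finset.inf_le (Finset.mem_univ g)
  refine le_antisymm (key true) ?_
  have h1 : ({η | η g = false} : Set (I → Bool)) = {η | η g = true}ᶜ := by ext; simp
  have h2 := key false
  rw [h1, map_compl'] at h2
  simpa using h2

end TruthTable

/-! ### Evaluation of free expressions in an algebra of the family -/

namespace PartialBooleanAlgebra

open scoped Classical

variable {X : Type u} {P : PartialBooleanAlgebra X}

theorem exists_context_superset [Finite X] (B : P.algebras) :
    ∃ C : P.algebras, P.IsContext (C : Set X) ∧ (B : Set X) ⊆ C := by
  obtain ⟨C, hBC, hC⟩ := (Set.toFinite P.algebras).exists_le_maximal B.2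
  exact ⟨⟨C, hC.1⟩, hC, hBC⟩

theorem exists_context_mem [Finite X] (x : X) :
    ∃ C : P.algebras, P.IsContext (C : Set X) ∧ x ∈ (C : Set X) := by
  obtain ⟨B, hB, hx⟩ : x ∈ ⋃₀ P.algebras := P.cover ▸ Set.mem_univ x
  obtain ⟨C, hC, hBC⟩ := exists_context_superset ⟨B, hB⟩
  exact ⟨C, hC, hBC hx⟩

theorem eqOn_freeSub {𝔅 : Type*} [BooleanAlgebra 𝔅] {G S : Finset X}
    (φ ψ : BoundedLatticeHom (FreeAlgebra G) 𝔅)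
    (h : ∀ g : G, (g : X) ∈ S → φ (freeGen G g) = ψ (freeGen G g))
    {A : FreeAlgebra G} (hA : A ∈ freeSub G S) : φ A = ψ A := by
  unfold freeSub at hA
  induction hA using BooleanSubalgebra.closure_bot_sup_induction with
  | mem x hx =>
    obtain ⟨g, hg, rfl⟩ := hx
    exact h g hg
  | bot => rw [map_bot, map_bot]
  | sup x hx y hy ihx ihy => rw [map_sup, map_sup, ihx, ihy]
  | compl x hx ih => rw [map_compl', map_compl', ih]

theorem freeSub_mono {G S T : Finset X} (h : S ⊆ T) : freeSub G S ≤ freeSub G T :=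
  BooleanSubalgebra.closure_mono fun _ ⟨g, hg, e⟩ => ⟨g, h hg, e⟩

theorem freeGen_mem_freeSub {G S : Finset X} {g : G} (h : (g : X) ∈ S) :
    freeGen G g ∈ freeSub G S :=
  BooleanSubalgebra.subset_closure ⟨g, h, rfl⟩

variable (P) in
/-- The value in the algebra `B` of an element of the free algebra. -/
noncomputable def evalIn (G : Finset X) (B : P.algebras) :
    BoundedLatticeHom (FreeAlgebra G) (B : Set X) :=
  freeLift fun g : G => P.toAlgebra B g

theorem evalIn_freeGen {G : Finset X} {B : P.algebras} {g : G} (h : (g : X) ∈ (B : Set X)) :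
    (P.evalIn G B (freeGen G g) : X) = g := by
  have := freeLift_gen (fun g : G => P.toAlgebra B g) g
  rw [toAlgebra_coe h] at this
  exact congrArg Subtype.val this

/-- Once S is enlarged to G, the minterms are the pairwise disjoint assignment meets whose join is
the value of A, and f is additive on B. -/
theorem freeMeasure_eq_evalIn {G S : Finset X} (f : P.State) (B : P.algebras)
    {A : FreeAlgebra G} (hA : DependsOnly G S A) (hS : S ⊆ G) :
    P.freeMeasure G f B S A = f (P.evalIn G B A) := by
  have key := (f.isMeasure B).finset_sup (Finset.univ.filter (· ∈ A))
    (assignmentMeet fun g : G => P.toAlgebra B g)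
    fun _ _ _ _ h => assignmentMeet_disjoint _ h
  -- Generators outside B are evaluated at the default ⊥. This is harmless: A depends only on S, so
  -- the two values of any other generator are summed out.
  rw [← freeMeasure_mono hA hS, freeMeasure_eq_sum (hA.mono hS), ← Finset.sum_filter]
  have hsum : f (P.evalIn G B A) = _ := Eq.trans (by rw [evalIn, freeLift_apply]; congr!) key
  rw [hsum]
  -- Subsets of G correspond to assignments through their indicator functions.
  refine Finset.sum_bij' (fun E _ (g : G) => decide ((g : X) ∈ E))
    (fun η _ => G.filter fun x => ∃ h : x ∈ G, η ⟨x, h⟩ = true) ?_ ?_ ?_ ?_ ?_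
  · intro E hE
    simpa using (Finset.mem_filter.1 hE).2
  · intro η hη
    refine Finset.mem_filter.2 ⟨Finset.mem_powerset.2 (Finset.filter_subset _ _), ?_⟩
    simpa using hη
  · intro E hE
    have hE := Finset.mem_powerset.1 (Finset.mem_filter.1 hE).1
    ext x
    simpa using fun h => hE h
  · intro η hη
    ext g
    simp
  · intro E hE
    refine congrArg (fun b : (B : Set X) => f b) ?_
    rw [minterm, assignmentMeet, ← Finset.inf_attach, Finset.univ_eq_attach]
    exact Finset.inf_congr rfl fun g _ => by simp

/-! ### Part (a): pulling back a representation -/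

namespace IsClassicalRepresentation

variable {f : P.State} {𝔅 : Type u} [BooleanAlgebra 𝔅] {ι : X → 𝔅} {μ : 𝔅 → ℝ}

theorem map_bot (h : P.IsClassicalRepresentation f ι μ) (B : P.algebras) :
    ι (⊥ : (B : Set X)) = ⊥ := by
  have h1 := h.map_inf B ⊥ ⊥ᶜ
  rwa [h.map_compl, inf_compl_eq_bot, inf_compl_eq_bot] at h1

/-- The restriction of the embedding to an algebra of the family. -/
def hom (h : P.IsClassicalRepresentation f ι μ) (B : P.algebras) :
    BoundedLatticeHom (B : Set X) 𝔅 where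
  toFun x := ι x
  map_sup' := h.map_sup B
  map_inf' := h.map_inf B
  map_top' := by rw [← compl_bot, h.map_compl, h.map_bot, compl_bot]
  map_bot' := h.map_bot B

/-- Both sides are homomorphisms in A that agree on the generators from S. The left one does not
mention B, so it glues the evaluations in all contexts. -/
theorem freeLift_eq (h : P.IsClassicalRepresentation f ι μ) {G S : Finset X} {B : P.algebras}
    (hS : (S : Set X) ⊆ B) {A : FreeAlgebra G} (hA : A ∈ freeSub G S) :
    freeLift (fun g : G => ι g) A = ι (P.evalIn G B A) := by
  refine eqOn_freeSub (freeLift fun g : G => ι g) ((h.hom B).comp (P.evalIn G B))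
    (fun g hg => ?_) hA
  exact (freeLift_gen (fun g : G => ι g) g).trans (congrArg ι (evalIn_freeGen (hS hg)).symm)

end IsClassicalRepresentation

theorem singleton_compatible [Finite X] (x : X) : P.Compatible {x} := by
  obtain ⟨B, hB, hx⟩ := P.exists_context_mem x
  exact ⟨B, hB, by simpa using hx⟩

theorem freeSub_mem_freeSubalgebras {G S : Finset X} (hS : S ⊆ G) (hc : P.Compatible S) :
    freeSub G S ∈ P.freeSubalgebras G :=
  ⟨S, hS, hc, le_rfl⟩

theorem free_hasClassicalRepresentation [Finite X] (G : Finset X) {f : P.State}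
    (hf : P.HasClassicalRepresentation f) :
    (P.free G).HasClassicalRepresentation (P.freeState G f) := by
  obtain ⟨𝔅, _, ι, μ, h⟩ := hf
  refine ⟨FreeAlgebra G, inferInstance, Subtype.val, fun A => μ (freeLift (fun g : G => ι g) A),
    Subtype.val_injective, fun _ _ _ => rfl, fun _ _ _ => rfl, fun _ _ => rfl, ?_,
    h.isMeasure.comp _, ?_⟩
  -- Distinct assignments differ at some g, and the free generator of g belongs to the free partial
  -- algebra because {g} is compatible.
  · refine BooleanSubalgebra.closure_eq_top_of_separates _ fun η θ hηθ => ?_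
    obtain ⟨g, hg⟩ := Function.ne_iff.1 hηθ
    refine ⟨freeGen G g, ⟨⟨freeGen G g, freeSub G {(g : X)}, ?_, ?_⟩, rfl⟩, ?_⟩
    · exact freeSub_mem_freeSubalgebras (by simp) (by simpa using singleton_compatible (g : X))
    · exact freeGen_mem_freeSub (by simp)
    · simpa [freeGen, ← Bool.eq_iff_iff] using hg
  · intro A
    obtain ⟨S, B, hS, hB, hSB, hA⟩ := exists_freeSub_mem A
    refine Eq.trans ?_ (freeValue_eq hSB hA).symm
    rw [freeMeasure_eq_evalIn f B (dependsOnly_of_mem hA) hS, h.freeLift_eq hSB hA,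
      h.extends_state]

/-! ### Part (b): measures on truth assignments -/

/-- The elements of `G` that lie in `B`. -/
noncomputable def generatorsIn (G : Finset X) (B : Set X) : Finset X := {g ∈ G | g ∈ B}

theorem mem_generatorsIn {G : Finset X} {B : Set X} {g : X} :
    g ∈ generatorsIn G B ↔ g ∈ G ∧ g ∈ B := by simp [generatorsIn]

theorem generatorsIn_subset {G : Finset X} {B : Set X} :
    (generatorsIn G B : Set X) ⊆ B := fun _ h => (mem_generatorsIn.1 h).2

theorem coe_generatorsIn {G : Finset X} {B : Set X} :
    (generatorsIn G B : Set X) = ↑G ∩ B := by ext; simp [mem_generatorsIn]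

/-- `m` is a measure on the free algebra which induces the state `f` on each context. -/
structure InducesState (G : Finset X) (f : P.State) (m : FreeAlgebra G → ℝ) : Prop where
  isMeasure : IsNormalizedMeasure m
  eq_state : ∀ B : P.algebras, P.IsContext (B : Set X) → ∀ A ∈ freeSub G (generatorsIn G B),
    m A = f (P.evalIn G B A)

/-- The representing measure is pulled back along the homomorphism extending the images of the free
generators. This homomorphism agrees with ι on each algebra freely generated within a context, since
ι respects the operations there. -/
theorem exists_inducesState [Finite X] {G : Finset X} {f : P.State}
    (hf : (P.free G).HasClassicalRepresentation (P.freeState G f)) :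
    ∃ m, InducesState G f m := by
  obtain ⟨𝔅, _, ι, μ, h⟩ := hf
  have hmem : ∀ g : G, ∃ L ∈ P.freeSubalgebras G, freeGen G g ∈ L := fun g =>
    ⟨freeSub G {(g : X)},
      freeSub_mem_freeSubalgebras (by simp) (by simpa using singleton_compatible (g : X)),
      freeGen_mem_freeSub (by simp)⟩
  refine ⟨fun A => μ (freeLift (fun g : G => ι ⟨freeGen G g, hmem g⟩) A),
    h.isMeasure.comp _, fun B hB A hA => ?_⟩
  have hL : freeSub G (generatorsIn G B) ∈ P.freeSubalgebras G :=
    freeSub_mem_freeSubalgebras (Finset.filter_subset _ _) ⟨B, hB, generatorsIn_subset⟩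
  have key : freeLift (fun g : G => ι ⟨freeGen G g, hmem g⟩) A = ι ⟨A, _, hL, hA⟩ := by
    let C : (P.free G).algebras := ⟨UnionOfSubalgebras.part _ _, _, hL, rfl⟩
    unfold freeSub at hA
    induction hA using BooleanSubalgebra.closure_bot_sup_induction with
    | mem x hx =>
      obtain ⟨g, hg, rfl⟩ := hx
      exact freeLift_gen _ g
    | bot =>
      rw [map_bot]
      exact (h.map_bot C).symm
    | sup x hx y hy ihx ihy =>
      rw [map_sup, ihx, ihy]
      exact (h.map_sup C ⟨⟨x, _, hL, hx⟩, hx⟩ ⟨⟨y, _, hL, hy⟩, hy⟩).symm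
    | compl x hx ih =>
      rw [map_compl', ih]
      exact (h.map_compl C ⟨⟨x, _, hL, hx⟩, hx⟩).symm
  refine (congrArg μ key).trans ((h.extends_state _).trans ?_)
  refine (freeValue_eq generatorsIn_subset hA).trans ?_
  exact freeMeasure_eq_evalIn f B (dependsOnly_of_mem hA) (Finset.filter_subset _ _)

/-! ### Generation of contexts and of their intersections -/

/-- The expression A is chosen before B: operations of different members coincide on common
elements, so one expression yields x in every algebra containing D. -/
theorem exists_evalIn_eq {G S : Finset X} {D : Set X} (hS : S ⊆ G)
    (h : P.GeneratesAlgebra (S : Set X) D) {x : X} (hx : x ∈ D) :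
    ∃ A ∈ freeSub G S, ∀ B : P.algebras, D ⊆ B → (P.evalIn G B A : X) = x := by
  obtain ⟨C, rfl, hSC, hgen⟩ := h
  have hx' : (⟨x, hx⟩ : (C : Set X)) ∈
      BooleanSubalgebra.closure {x : (C : Set X) | (x : X) ∈ (S : Set X)} :=
    hgen ▸ BooleanSubalgebra.mem_top
  suffices ∀ y : (C : Set X), y ∈ BooleanSubalgebra.closure
      {x : (C : Set X) | (x : X) ∈ (S : Set X)} →
      ∃ A ∈ freeSub G S, ∀ B : P.algebras, (C : Set X) ⊆ B → (P.evalIn G B A : X) = y from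
    this _ hx'
  intro y hy
  induction hy using BooleanSubalgebra.closure_bot_sup_induction with
  | mem y hy =>
    exact ⟨freeGen G ⟨y, hS hy⟩, freeGen_mem_freeSub hy, fun B hB => evalIn_freeGen (hB y.2)⟩
  | bot => exact ⟨⊥, BooleanSubalgebra.bot_mem, fun B _ => by rw [map_bot, P.coe_bot_eq]⟩
  | sup y _ z _ ihy ihz =>
    obtain ⟨A, hA, hAy⟩ := ihy
    obtain ⟨A', hA', hAz⟩ := ihz
    refine ⟨A ⊔ A', BooleanSubalgebra.sup_mem hA hA', fun B hB => ?_⟩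
    have h1 : P.evalIn G B A = ⟨y, hB y.2⟩ := Subtype.ext (hAy B hB)
    have h2 : P.evalIn G B A' = ⟨z, hB z.2⟩ := Subtype.ext (hAz B hB)
    rw [map_sup, h1, h2]
    exact P.sup_eq B C _ _ _ _ _ _
  | compl y _ ihy =>
    obtain ⟨A, hA, hAy⟩ := ihy
    refine ⟨Aᶜ, BooleanSubalgebra.compl_mem hA, fun B hB => ?_⟩
    have h1 : P.evalIn G B A = ⟨y, hB y.2⟩ := Subtype.ext (hAy B hB)
    rw [map_compl', h1]
    exact P.compl_eq B C _ _ _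

theorem GeneratesAlgebra.mono {S T B : Set X} (h : P.GeneratesAlgebra S B) (hST : S ⊆ T)
    (hT : T ⊆ B) : P.GeneratesAlgebra T B := by
  obtain ⟨C, hC, -, hgen⟩ := h
  refine ⟨C, hC, hT, top_le_iff.1 ?_⟩
  rw [← hgen]
  exact BooleanSubalgebra.closure_mono fun x hx => hST hx

theorem GeneratesAlgebra.subset {S B : Set X} (h : P.GeneratesAlgebra S B) (C : P.algebras)
    (hSC : S ⊆ C) : B ⊆ C := by
  obtain ⟨B, rfl, hSB, hgen⟩ := h
  intro x hx
  suffices ∀ y : (B : Set X), y ∈ BooleanSubalgebra.closure {x : (B : Set X) | (x : X) ∈ S} →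
      (y : X) ∈ (C : Set X) from this ⟨x, hx⟩ (hgen ▸ BooleanSubalgebra.mem_top)
  intro y hy
  induction hy using BooleanSubalgebra.closure_bot_sup_induction with
  | mem y hy => exact hSC hy
  | bot => rw [P.coe_bot_eq B C]; exact Subtype.coe_prop _
  | sup y _ z _ ihy ihz =>
    have := P.sup_eq B C y z y.2 z.2 ihy ihz
    simp only [Subtype.coe_eta] at this
    rw [this]; exact Subtype.coe_prop _
  | compl y _ ihy =>
    have := P.compl_eq B C y y.2 ihy
    simp only [Subtype.coe_eta] at this
    rw [this]; exact Subtype.coe_prop _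

theorem IsGenerating.generatorsIn {G : Finset X} (hG : P.IsGenerating (G : Set X)) {B : Set X}
    (hB : P.IsContext B) : P.GeneratesAlgebra (generatorsIn G B : Set X) B := by
  obtain ⟨S, hSG, hS⟩ := hG B hB
  refine hS.mono ?_ generatorsIn_subset
  obtain ⟨C, rfl, hSC, -⟩ := hS
  exact coe_generatorsIn ▸ Set.subset_inter hSG hSC

/-- A context containing a larger compatible set contains the generators of B, hence B, hence equals
B by maximality. -/
theorem IsGenerating.isMaximalCompatible {G : Finset X} (hG : P.IsGenerating (G : Set X))
    {B : Set X} (hB : P.IsContext B) :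
    P.IsMaximalCompatible (G : Set X) (PartialBooleanAlgebra.generatorsIn G B : Set X) := by
  refine ⟨⟨by simp [coe_generatorsIn], B, hB, generatorsIn_subset⟩, ?_⟩
  rintro T ⟨hTG, C, hC, hTC⟩ hST
  have hBC : B ⊆ C := (hG.generatorsIn hB).subset ⟨C, hC.1⟩ (hST.trans hTC)
  have hCB : C ⊆ B := hB.2 hC.1 hBC
  exact coe_generatorsIn ▸ Set.subset_inter hTG (hTC.trans hCB)

/-- This is where property (G) enters, for two contexts: the shared generators generate the
intersection, so x has an expression usable in both. -/
theorem exists_evalIn_eq_of_mem_inter {G : Finset X} (hG : P.IsGenerating (G : Set X))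
    (hGprop : P.PropertyG (G : Set X)) {B C : P.algebras} (hB : P.IsContext (B : Set X))
    (hC : P.IsContext (C : Set X)) {x : X} (hxB : x ∈ (B : Set X)) (hxC : x ∈ (C : Set X)) :
    ∃ A ∈ freeSub G (generatorsIn G B) ⊓ freeSub G (generatorsIn G C),
      (P.evalIn G B A : X) = x ∧ (P.evalIn G C A : X) = x := by
  -- Property (G) says nothing about a trivial intersection, but there ⊥ and ⊤ are expressions
  -- common to all contexts.
  by_cases hne : (B : Set X) ∩ C = {P.zero, P.one}
  · have hx : x ∈ ({P.zero, P.one} : Set X) := hne ▸ ⟨hxB, hxC⟩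
    rcases hx with rfl | rfl
    · exact ⟨⊥, BooleanSubalgebra.bot_mem, by rw [map_bot, coe_bot], by rw [map_bot, coe_bot]⟩
    · exact ⟨⊤, BooleanSubalgebra.top_mem, by rw [map_top, coe_top], by rw [map_top, coe_top]⟩
  · have h := hGprop 2 (by norm_num) ![B, C]
      ![(generatorsIn G B : Set X), (generatorsIn G C : Set X)]
      (by simp [Fin.forall_fin_two, hB, hC])
      (by simp [Fin.forall_fin_two, hG.isMaximalCompatible, hG.generatorsIn, hB, hC])
    have e : ∀ S T : Set X, ⋂ i, (![S, T] : Fin 2 → Set X) i = S ∩ T := by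
      intro S T
      ext; simp [Fin.forall_fin_two]
    rw [e, e, ← Finset.coe_inter] at h
    obtain ⟨A, hA, hAx⟩ := exists_evalIn_eq (G := G)
      (Finset.inter_subset_left.trans (Finset.filter_subset _ _)) (h hne).2 ⟨hxB, hxC⟩
    exact ⟨A, ⟨freeSub_mono Finset.inter_subset_left hA, freeSub_mono Finset.inter_subset_right hA⟩,
      hAx B Set.inter_subset_left, hAx C Set.inter_subset_right⟩

/-! ### The representation by consistent assignments -/

variable (P) in
/-- The assignments that falsify every element of the free algebra that vanishes in a context. -/
def consistentAssignments (G : Finset X) : Set (G → Bool) :=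
  {η | ∀ B : P.algebras, P.IsContext (B : Set X) → ∀ A ∈ freeSub G (generatorsIn G B),
    P.evalIn G B A = ⊥ → η ∉ A}

/-- `A` is an expression for `x` in terms of the generators in some context. -/
def Expresses (G : Finset X) (A : FreeAlgebra G) (x : X) : Prop :=
  ∃ B : P.algebras, P.IsContext (B : Set X) ∧ A ∈ freeSub G (generatorsIn G B) ∧
    (P.evalIn G B A : X) = x

/-- The differences A \ A' and A' \ A evaluate to ⊥, so a consistent assignment avoids both. -/
theorem mem_iff_of_evalIn_eq {G : Finset X} {B : P.algebras} (hB : P.IsContext (B : Set X))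
    {A A' : FreeAlgebra G} (hA : A ∈ freeSub G (generatorsIn G B))
    (hA' : A' ∈ freeSub G (generatorsIn G B)) (h : P.evalIn G B A = P.evalIn G B A')
    {η : G → Bool} (hη : η ∈ P.consistentAssignments G) : η ∈ A ↔ η ∈ A' := by
  have h1 := hη B hB (A \ A') (BooleanSubalgebra.sdiff_mem hA hA')
    (by rw [map_sdiff', h, sdiff_self])
  have h2 := hη B hB (A' \ A) (BooleanSubalgebra.sdiff_mem hA' hA)
    (by rw [map_sdiff', h, sdiff_self])
  simp only [Set.mem_sdiff] at h1 h2
  tauto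

/-- Both expressions are compared, each in its own context, with one expression D valid in the two
contexts. -/
theorem Expresses.mem_iff {G : Finset X} (hG : P.IsGenerating (G : Set X))
    (hGprop : P.PropertyG (G : Set X)) {A A' : FreeAlgebra G} {x : X}
    (hA : Expresses (P := P) G A x) (hA' : Expresses (P := P) G A' x)
    {η : G → Bool} (hη : η ∈ P.consistentAssignments G) : η ∈ A ↔ η ∈ A' := by
  obtain ⟨B, hB, hAB, rfl⟩ := hA
  obtain ⟨C, hC, hAC, hx⟩ := hA'
  obtain ⟨D, hD, hDB, hDC⟩ := exists_evalIn_eq_of_mem_inter hG hGprop hB hC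
    (P.evalIn G B A).2 (hx ▸ (P.evalIn G C A').2)
  rw [mem_iff_of_evalIn_eq hB hAB hD.1 (Subtype.ext hDB.symm) hη,
    mem_iff_of_evalIn_eq hC hAC hD.2 (Subtype.ext (hx.trans hDC.symm)) hη]

variable (P) in
/-- The set of the consistent assignments for which `x` is true. -/
def truthSet (G : Finset X) (x : X) : Set (P.consistentAssignments G) :=
  {η | ∃ A, Expresses (P := P) G A x ∧ η.1 ∈ A}

theorem truthSet_eq {G : Finset X} (hG : P.IsGenerating (G : Set X))
    (hGprop : P.PropertyG (G : Set X)) {A : FreeAlgebra G} {x : X}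
    (hA : Expresses (P := P) G A x) : P.truthSet G x = (↑) ⁻¹' A := by
  ext η
  exact ⟨fun ⟨_, hA', hη⟩ => (hA'.mem_iff hG hGprop hA η.2).1 hη, fun hη => ⟨A, hA, hη⟩⟩

theorem exists_evalIn_eq_of_mem {G : Finset X} (hG : P.IsGenerating (G : Set X))
    {B : P.algebras} (hB : P.IsContext (B : Set X)) {x : X} (hx : x ∈ (B : Set X)) :
    ∃ A ∈ freeSub G (generatorsIn G B), (P.evalIn G B A : X) = x := by
  obtain ⟨A, hA, h⟩ := exists_evalIn_eq (G := G) (Finset.filter_subset _ _) (hG.generatorsIn hB) hx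
  exact ⟨A, hA, h B subset_rfl⟩

/-- Every inconsistent assignment lies in some A whose measure is f(⊥) = 0; there are finitely many
assignments. -/
theorem InducesState.measure_compl {G : Finset X} {f : P.State} {m : FreeAlgebra G → ℝ}
    (hm : InducesState G f m) : m (P.consistentAssignments G)ᶜ = 0 := by
  refine hm.isMeasure.eq_zero_of_forall_singleton fun η hη => ?_
  simp only [consistentAssignments, Set.mem_compl_iff, Set.mem_ofPred_eq, not_forall,
    not_not] at hη
  obtain ⟨B, hB, A, hA, h0, hηA⟩ := hη
  have h1 : m A = 0 := by rw [hm.eq_state B hB A hA, h0]; exact (f.isMeasure B).bot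
  have h2 : m {η} ≤ m A := hm.isMeasure.mono (Set.singleton_subset_iff.2 hηA)
  linarith [hm.isMeasure.nonneg {η}]

theorem InducesState.measure_truthSet [Finite X] {G : Finset X}
    (hG : P.IsGenerating (G : Set X)) (hGprop : P.PropertyG (G : Set X)) {f : P.State}
    {m : FreeAlgebra G → ℝ} (hm : InducesState G f m) (x : X) :
    m (Subtype.val '' P.truthSet G x) = f x := by
  obtain ⟨B, hB, hx⟩ := P.exists_context_mem x
  obtain ⟨A, hA, hAx⟩ := exists_evalIn_eq_of_mem hG hB hx
  rw [truthSet_eq hG hGprop ⟨B, hB, hA, hAx⟩, hm.isMeasure.image_preimage hm.measure_compl,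
    hm.eq_state B hB A hA, hAx]

theorem truthSet_inf [Finite X] {G : Finset X} (hG : P.IsGenerating (G : Set X))
    (hGprop : P.PropertyG (G : Set X)) (B : P.algebras) (x y : (B : Set X)) :
    P.truthSet G ↑(x ⊓ y) = P.truthSet G x ⊓ P.truthSet G y := by
  -- Expressions are available in contexts only, so the computation moves from B to a context
  -- containing it.
  obtain ⟨C, hC, hBC⟩ := exists_context_superset B
  obtain ⟨A, hA, hAx⟩ := exists_evalIn_eq_of_mem hG hC (hBC x.2)
  obtain ⟨A', hA', hAy⟩ := exists_evalIn_eq_of_mem hG hC (hBC y.2)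
  have h : Expresses (P := P) G (A ⊓ A') ↑(x ⊓ y) := by
    refine ⟨C, hC, BooleanSubalgebra.inf_mem hA hA', ?_⟩
    rw [map_inf, show P.evalIn G C A = ⟨x, hBC x.2⟩ from Subtype.ext hAx,
      show P.evalIn G C A' = ⟨y, hBC y.2⟩ from Subtype.ext hAy]
    exact P.inf_eq C B _ _ _ _ x.2 y.2
  rw [truthSet_eq hG hGprop h, truthSet_eq hG hGprop ⟨C, hC, hA, hAx⟩,
    truthSet_eq hG hGprop ⟨C, hC, hA', hAy⟩]
  rfl

theorem truthSet_compl [Finite X] {G : Finset X} (hG : P.IsGenerating (G : Set X))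
    (hGprop : P.PropertyG (G : Set X)) (B : P.algebras) (x : (B : Set X)) :
    P.truthSet G ↑(xᶜ) = (P.truthSet G x)ᶜ := by
  obtain ⟨C, hC, hBC⟩ := exists_context_superset B
  obtain ⟨A, hA, hAx⟩ := exists_evalIn_eq_of_mem hG hC (hBC x.2)
  have h : Expresses (P := P) G Aᶜ ↑(xᶜ) := by
    refine ⟨C, hC, BooleanSubalgebra.compl_mem hA, ?_⟩
    rw [map_compl', show P.evalIn G C A = ⟨x, hBC x.2⟩ from Subtype.ext hAx]
    exact P.compl_eq C B _ _ x.2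
  rw [truthSet_eq hG hGprop h, truthSet_eq hG hGprop ⟨C, hC, hA, hAx⟩]
  rfl

theorem truthSet_sup [Finite X] {G : Finset X} (hG : P.IsGenerating (G : Set X))
    (hGprop : P.PropertyG (G : Set X)) (B : P.algebras) (x y : (B : Set X)) :
    P.truthSet G ↑(x ⊔ y) = P.truthSet G x ⊔ P.truthSet G y := by
  have h : x ⊔ y = (xᶜ ⊓ yᶜ)ᶜ := by simp
  rw [h, truthSet_compl hG hGprop, truthSet_inf hG hGprop, truthSet_compl hG hGprop,
    truthSet_compl hG hGprop, compl_inf, compl_compl, compl_compl]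

theorem closure_range_truthSet [Finite X] {G : Finset X} (hG : P.IsGenerating (G : Set X))
    (hGprop : P.PropertyG (G : Set X)) :
    BooleanSubalgebra.closure (Set.range (P.truthSet G)) = ⊤ := by
  refine BooleanSubalgebra.closure_eq_top_of_separates _ fun η θ hηθ => ?_
  obtain ⟨g, hg⟩ := Function.ne_iff.1 (fun h => hηθ (Subtype.ext h))
  refine ⟨_, ⟨(g : X), rfl⟩, ?_⟩
  obtain ⟨B, hB, hgB⟩ := P.exists_context_mem (g : X)
  rw [truthSet_eq hG hGprop (A := freeGen G g)
    ⟨B, hB, freeGen_mem_freeSub (mem_generatorsIn.2 ⟨g.2, hgB⟩), evalIn_freeGen hgB⟩]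
  simpa [freeGen, ← Bool.eq_iff_iff] using hg

theorem InducesState.hasClassicalRepresentation [Finite X] {G : Finset X}
    (hG : P.IsGenerating (G : Set X)) (hGprop : P.PropertyG (G : Set X))
    (hinj : Function.Injective (P.truthSet G)) {f : P.State}
    {m : FreeAlgebra G → ℝ} (hm : InducesState G f m) : P.HasClassicalRepresentation f :=
  ⟨Set (P.consistentAssignments G), inferInstance, P.truthSet G,
    fun A => m (Subtype.val '' A), hinj, truthSet_inf hG hGprop, truthSet_sup hG hGprop,
    truthSet_compl hG hGprop, closure_range_truthSet hG hGprop,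
    hm.isMeasure.restrict hm.measure_compl, hm.measure_truthSet hG hGprop⟩

end PartialBooleanAlgebra

theorem theorem1 {X : Type u} [Finite X] (P : PartialBooleanAlgebra X) {K : Type v}
    (f : K → P.State) (hf : PartialBooleanAlgebra.Complete f)
    (G : Finset X) (hG : P.IsGenerating (G : Set X)) (hGprop : P.PropertyG (G : Set X)) :
    (∀ k : K, P.HasClassicalRepresentation (f k) →
      (P.free G).HasClassicalRepresentation (P.freeState G (f k))) ∧
    (∀ K' : Set K, PartialBooleanAlgebra.Separating (fun k : K' => f k) →
      (∀ k ∈ K', (P.free G).HasClassicalRepresentation (P.freeState G (f k))) →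
      ∀ k ∈ K', P.HasClassicalRepresentation (f k)) := by
  refine ⟨fun k => PartialBooleanAlgebra.free_hasClassicalRepresentation G,
    fun K' hsep hfree k hk => ?_⟩
  -- The state separating x from y need not be f k; any l in K' will do, because the truth sets are
  -- the same for all states.
  have hinj : Function.Injective (P.truthSet G) := by
    intro x y hxy
    by_contra hne
    obtain ⟨l, hl⟩ := hsep.2 x y hne
    obtain ⟨m, hm⟩ := PartialBooleanAlgebra.exists_inducesState (hfree l l.2)
    apply hl
    rw [← hm.measure_truthSet hG hGprop x, hxy, hm.measure_truthSet hG hGprop y]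
  obtain ⟨m, hm⟩ := PartialBooleanAlgebra.exists_inducesState (hfree k hk)
  exact hm.hasClassicalRepresentation hG hGprop hinj
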